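/- Let $X=\{0,1\}$ and let $\mathcal G\le \mathrm{Aut}(X^*)$ be the group of automorphisms of the rooted binary tree $X^*$ generated by the automorphisms $a,b,c,d$ defined by the wreath recursion $$a=(d,d)\sigma,\qquad b=(c,c),\qquad c=(a,b),\qquad d=(b,a),$$ where $\sigma$ is the transposition of $0$ and $1$; that is, for every $v\in X^*$, $a(0v)=1\,d(v)$, $a(1v)=0\,d(v)$, $b(xv)=x\,c(v)$ for $x\in X$, $c(0v)=0\,a(v)$, $c(1v)=1\,b(v)$, $d(0v)=0\,b(v)$, $d(1v)=1\,a(v)$, and each of $a,b,c,d$ fixes the empty word. Products are taken with the convention $(gh)(v)=h(g(v))$. Then every nonempty finite word over $\{a,b,c,d\}$ that contains none of $a^2,b^2,c^2,d^2,ab,ba,cd,dc$ as a subword (i.e. as a contiguous factor) represents a nontrivial element of $\mathcal G$. In particular, the subsemigroups $\langle ac,ad,bc,bd\rangle_+$ and $\langle ca,da,cb,db\rangle_+$ of $\mathcal G$ generated by these elements are torsion-free, i.e. each of their elements $s$ has infinite order (the powers $s,s^2,s^3,\dots$ are pairwise distinct). -/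

import Mathlib

/-- A Mealy automaton with set of states `Q`, alphabet `X`, transition function `next` and output
function `out`. -/
structure MealyAutomaton (Q X : Type*) where
  next : Q → X → Q
  out : Q → X → X

namespace MealyAutomaton

variable {Q X : Type*}

/-- The automaton is invertible if every state permutes the alphabet. -/
def Invertible (A : MealyAutomaton Q X) : Prop := ∀ q, Function.Bijective (A.out q)

/-- The output function extended to words: the transformation of `X^*` given by the state `q`. -/
def act (A : MealyAutomaton Q X) : Q → List X → List X
  | _, [] => []
  | q, x :: v => A.out q x :: A.act (A.next q x) v

theorem act_bijective (A : MealyAutomaton Q X) (hA : A.Invertible) (q : Q) :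
    Function.Bijective (A.act q) := by
  constructor
  · intro u v h
    induction u generalizing q v with
    | nil => cases v with
      | nil => rfl
      | cons y v => simp [act] at h
    | cons x u ih => cases v with
      | nil => simp [act] at h
      | cons y v =>
        simp only [act, List.cons.injEq] at h
        obtain rfl := (hA q).1 h.1
        rw [ih _ h.2]
  · intro v
    induction v generalizing q with
    | nil => exact ⟨[], rfl⟩
    | cons y v ih =>
      obtain ⟨x, rfl⟩ := (hA q).2 y
      obtain ⟨u, rfl⟩ := ih (A.next q x)
      exact ⟨x :: u, rfl⟩

theorem act_prefix_iff (A : MealyAutomaton Q X) (hA : A.Invertible) (q : Q) (u v : List X) :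
    A.act q u <+: A.act q v ↔ u <+: v := by
  induction u generalizing q v with
  | nil => simp [act]
  | cons x u ih => cases v with
    | nil => simp [act]
    | cons y v =>
      simp only [act, List.cons_prefix_cons]
      constructor
      · rintro ⟨h1, h2⟩
        obtain rfl := (hA q).1 h1
        exact ⟨rfl, (ih _ _).1 h2⟩
      · rintro ⟨rfl, h2⟩
        exact ⟨rfl, (ih _ _).2 h2⟩

end MealyAutomaton

/-- `Aut(X^*)`: the automorphisms of the rooted tree of finite words over `X`, i.e. the
permutations of `X^*` that preserve and reflect the relation of being a prefix.
The opposite group is taken so that products follow the convention `(g * h)(v) = h (g v)`. -/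
def TreeAut (X : Type*) : Subgroup (Equiv.Perm (List X))ᵐᵒᵖ where
  carrier := {g | ∀ u v : List X, g.unop u <+: g.unop v ↔ u <+: v}
  one_mem' := fun _ _ => Iff.rfl
  mul_mem' := fun {_ _} hg hh _ _ => (hh _ _).trans (hg _ _)
  inv_mem' := fun {g} hg u v => by
    have h := hg (g.unop.symm u) (g.unop.symm v)
    simp only [Equiv.apply_symm_apply] at h
    exact h.symm

namespace MealyAutomaton

variable {Q X : Type*}

/-- The tree automorphism defined by a state of an invertible automaton. -/
noncomputable def stateAut (A : MealyAutomaton Q X) (hA : A.Invertible) (q : Q) : TreeAut X :=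
  ⟨MulOpposite.op (Equiv.ofBijective (A.act q) (A.act_bijective hA q)), A.act_prefix_iff hA q⟩

/-- The automaton group: the group of tree automorphisms generated by all states. -/
def automatonGroup (A : MealyAutomaton Q X) (hA : A.Invertible) : Subgroup (TreeAut X) :=
  Subgroup.closure (Set.range (A.stateAut hA))

/-- A state as an element of the automaton group. -/
noncomputable def gen (A : MealyAutomaton Q X) (hA : A.Invertible) (q : Q) :
    A.automatonGroup hA :=
  ⟨A.stateAut hA q, Subgroup.subset_closure ⟨q, rfl⟩⟩

/-- The element of the automaton group represented by a word over the set of states. -/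
noncomputable def eval (A : MealyAutomaton Q X) (hA : A.Invertible) (w : List Q) :
    A.automatonGroup hA :=
  (w.map (A.gen hA)).prod

end MealyAutomaton

/-- A subsemigroup is torsion-free if each of its elements `s` has infinite order, i.e. the powers
`s, s ^ 2, s ^ 3, …` are pairwise distinct. -/
def Subsemigroup.HasNoTorsion {M : Type*} [Monoid M] (S : Subsemigroup M) : Prop :=
  ∀ s ∈ S, ∀ m n : ℕ, 1 ≤ m → 1 ≤ n → s ^ m = s ^ n → m = n

/-- The four states of the automaton `autC`. -/
inductive StateG where
  | a | b | c | d

/-- The automaton over `{0, 1}` with wreath recursion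
`a = (d, d)σ`, `b = (c, c)`, `c = (a, b)`, `d = (b, a)`. -/
def autC : MealyAutomaton StateG (Fin 2) where
  next
    | .a, _ => .d
    | .b, _ => .c
    | .c, x => if x = 0 then .a else .b
    | .d, x => if x = 0 then .b else .a
  out
    | .a, x => Equiv.swap 0 1 x
    | .b, x => x
    | .c, x => x
    | .d, x => x

theorem autC_invertible : autC.Invertible := by
  intro q
  cases q
  · exact (Equiv.swap (0 : Fin 2) 1).bijective
  all_goals exact Function.bijective_id

/-- The group generated by `autC`. -/
abbrev GroupG : Type := autC.automatonGroup autC_invertible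

/-- The element of `GroupG` represented by a word over `{a, b, c, d}`. -/
noncomputable def evalG (w : List StateG) : GroupG := autC.eval autC_invertible w

/-- The forbidden words `a², b², c², d², ab, ba, cd, dc`. -/
def forbiddenG : Set (List StateG) :=
  {[.a, .a], [.b, .b], [.c, .c], [.d, .d], [.a, .b], [.b, .a], [.c, .d], [.d, .c]}

/-! The forbidden factors leave exactly the words alternating between `{a, b}` and `{c, d}`. Label
`b`, `a` and `c`, `d` by `0`, `1` in `ZMod 2`. An even word starting in `{a, b}` is then a pair of
power series, truncated at degree `m`. Write `G = 1 + X + ⋯`. Since an output letter is changed by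
partial sums of labels, that is, by multiplication by `G`, passing to the section at a two-letter
word is an affine map on such pairs.

If the word acts trivially, so do all its sections, and each of these gives the vanishing of one
coefficient. Comparing the sections at `00⋯0` and `10⋯0` cancels the unknown labels and leaves
explicit series `D_k` (`sectionDiff`) with `coeff m (G * (D_k).2) = 0`. By Cayley–Hamilton the span
of the `(D_k).2` is stable under multiplication by `X * G ^ 2`, so it contains `(X * G ^ 2) ^ m *
G`. Multiplied by `G`, this has coefficient `1` at degree `m`, a contradiction
(`not_actsTrivially_seriesWord`). Other alternating words reduce to this case through sections. -/

namespace MealyAutomaton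

variable {Q X : Type*}

/-- The transformation of `X^*` given by a word over the states, read from left to right. -/
def actWord (A : MealyAutomaton Q X) : List Q → List X → List X
  | [], v => v
  | q :: w, v => A.actWord w (A.act q v)

/-- The output of a word over the states on a letter. -/
def outWord (A : MealyAutomaton Q X) : List Q → X → X
  | [], x => x
  | q :: w, x => A.outWord w (A.out q x)

/-- The section of a word over the states at a letter. -/
def nextWord (A : MealyAutomaton Q X) : List Q → X → List Q
  | [], _ => []
  | q :: w, x => A.next q x :: A.nextWord w (A.out q x)

theorem actWord_cons_letter (A : MealyAutomaton Q X) (w : List Q) (x : X) (v : List X) :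
    A.actWord w (x :: v) = A.outWord w x :: A.actWord (A.nextWord w x) v := by
  induction w generalizing x v with
  | nil => rfl
  | cons q w ih => exact ih _ _

theorem actWord_append (A : MealyAutomaton Q X) (u w : List Q) (v : List X) :
    A.actWord (u ++ w) v = A.actWord w (A.actWord u v) := by
  induction u generalizing v with
  | nil => rfl
  | cons q u ih => exact ih _

theorem outWord_append (A : MealyAutomaton Q X) (u w : List Q) (x : X) :
    A.outWord (u ++ w) x = A.outWord w (A.outWord u x) := by
  induction u generalizing x with
  | nil => rfl
  | cons q u ih => exact ih _

theorem nextWord_append (A : MealyAutomaton Q X) (u w : List Q) (x : X) :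
    A.nextWord (u ++ w) x = A.nextWord u x ++ A.nextWord w (A.outWord u x) := by
  induction u generalizing x with
  | nil => rfl
  | cons q u ih => simp [nextWord, outWord, ih]

theorem eval_apply (A : MealyAutomaton Q X) (hA : A.Invertible) (w : List Q) (v : List X) :
    (A.eval hA w).1.1.unop v = A.actWord w v := by
  induction w generalizing v with
  | nil => rfl
  | cons q w ih =>
    have h : A.eval hA (q :: w) = A.gen hA q * A.eval hA w := by simp [eval]
    rw [h]
    exact ih (A.act q v)

theorem eval_append (A : MealyAutomaton Q X) (hA : A.Invertible) (u w : List Q) :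
    A.eval hA (u ++ w) = A.eval hA u * A.eval hA w := by
  simp [eval]

/-- A word over the states acts trivially if it fixes every word over the alphabet. -/
def ActsTrivially (A : MealyAutomaton Q X) (w : List Q) : Prop := ∀ v, A.actWord w v = v

theorem actsTrivially_of_eval_eq_one (A : MealyAutomaton Q X) (hA : A.Invertible) {w : List Q}
    (h : A.eval hA w = 1) : A.ActsTrivially w := by
  intro v
  rw [← A.eval_apply hA, h]
  rfl

variable {A : MealyAutomaton Q X} {u w : List Q}

theorem ActsTrivially.outWord (h : A.ActsTrivially w) (x : X) : A.outWord w x = x := by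
  have := h [x]
  rw [actWord_cons_letter, List.cons.injEq] at this
  exact this.1

theorem ActsTrivially.nextWord (h : A.ActsTrivially w) (x : X) :
    A.ActsTrivially (A.nextWord w x) := by
  intro v
  have := h (x :: v)
  rw [actWord_cons_letter, List.cons.injEq] at this
  exact this.2

theorem ActsTrivially.append (hu : A.ActsTrivially u) (hw : A.ActsTrivially w) :
    A.ActsTrivially (u ++ w) := by
  intro v
  rw [actWord_append, hu, hw]

end MealyAutomaton

/-- Cancelling two equal powers with distinct exponents leaves a positive power equal to `1`, which
would lie in `S`. -/
theorem Subsemigroup.hasNoTorsion_of_one_notMem {G : Type*} [Group G] {S : Subsemigroup G}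
    (h : (1 : G) ∉ S) : S.HasNoTorsion := by
  have hpow : ∀ s ∈ S, ∀ k : ℕ, s ^ (k + 1) ∈ S := by
    intro s hs k
    induction k with
    | zero => simpa using hs
    | succ k ih => rw [pow_succ]; exact S.mul_mem ih hs
  have key : ∀ s ∈ S, ∀ m n : ℕ, s ^ m = s ^ n → ¬ m < n := by
    intro s hs m n hmn hlt
    obtain ⟨k, rfl⟩ := Nat.exists_eq_add_of_lt hlt
    rw [add_assoc, pow_add] at hmn
    exact h (left_eq_mul.1 hmn ▸ hpow s hs k)
  intro s hs m n _ _ hmn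
  have h1 := key s hs m n hmn
  have h2 := key s hs n m hmn.symm
  omega

/-! ### Bit labels for the states -/

namespace StateG

/-- Whether a state is one of `a`, `b`. -/
def isAB : StateG → Bool
  | a => true
  | b => true
  | c => false
  | d => false

/-- The states `b`, `a` labelled by `0`, `1`. -/
def ofBitAB (s : ZMod 2) : StateG := if s = 0 then b else a

/-- The states `c`, `d` labelled by `0`, `1`. -/
def ofBitCD (s : ZMod 2) : StateG := if s = 0 then c else d

/-- An element of `ZMod 2` as a letter of the alphabet. -/
def letter (x : ZMod 2) : Fin 2 := x

theorem exists_ofBitAB {q : StateG} (h : q.isAB = true) : ∃ s, q = ofBitAB s := by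
  cases q
  · exact ⟨1, rfl⟩
  · exact ⟨0, rfl⟩
  · cases h
  · cases h

theorem exists_ofBitCD {q : StateG} (h : q.isAB = false) : ∃ s, q = ofBitCD s := by
  cases q
  · cases h
  · cases h
  · exact ⟨0, rfl⟩
  · exact ⟨1, rfl⟩

theorem out_ofBitAB (s x : ZMod 2) : autC.out (ofBitAB s) (letter x) = letter (x + s) := by
  fin_cases s <;> fin_cases x <;> rfl

theorem out_ofBitCD (s x : ZMod 2) : autC.out (ofBitCD s) (letter x) = letter x := by
  fin_cases s <;> fin_cases x <;> rfl

theorem next_ofBitAB (s x : ZMod 2) : autC.next (ofBitAB s) (letter x) = ofBitCD s := by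
  fin_cases s <;> fin_cases x <;> rfl

theorem next_ofBitCD (s x : ZMod 2) : autC.next (ofBitCD s) (letter x) = ofBitAB (1 + s + x) := by
  fin_cases s <;> fin_cases x <;> rfl

theorem isAB_next (q : StateG) (x : Fin 2) : (autC.next q x).isAB = !q.isAB := by
  cases q <;> fin_cases x <;> rfl

end StateG

open StateG PowerSeries

/-! ### Alternating words and their sections -/

/-- The list of length `n` of alternating Boolean values starting with `i`. -/
def alternating : Bool → ℕ → List Bool
  | _, 0 => []
  | i, n + 1 => i :: alternating (!i) n

theorem map_not_alternating (i : Bool) (n : ℕ) :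
    (alternating i n).map not = alternating (!i) n := by
  induction n generalizing i with
  | zero => rfl
  | succ n ih => simp [alternating, ih]

theorem alternating_append_of_even (i : Bool) (m n : ℕ) :
    alternating i (2 * m) ++ alternating i n = alternating i (2 * m + n) := by
  induction m with
  | zero => simp [alternating]
  | succ m ih =>
    rw [show 2 * (m + 1) + n = 2 * m + n + 1 + 1 by ring, show 2 * (m + 1) = 2 * m + 1 + 1 by ring]
    simp [alternating, ih]

theorem alternating_append_of_odd (i : Bool) (m n : ℕ) :
    alternating i (2 * m + 1) ++ alternating (!i) n = alternating i (2 * m + 1 + n) := by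
  rw [show 2 * m + 1 + n = 2 * m + n + 1 by ring]
  simp only [alternating, List.cons_append, alternating_append_of_even]

theorem map_isAB_nextWord (w : List StateG) (x : Fin 2) :
    (autC.nextWord w x).map isAB = (w.map isAB).map not := by
  induction w generalizing x with
  | nil => rfl
  | cons q w ih => simp [MealyAutomaton.nextWord, ih, isAB_next]

/-- The word of length `2 * m` alternating between the states with labels in `p` and `q`. -/
def wordAB (p q : ℕ → ZMod 2) (m : ℕ) : List StateG :=
  (List.range m).flatMap fun i => [ofBitAB (p i), ofBitCD (q i)]

/-- The sections of the words `wordAB`. -/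
def wordCD (p q : ℕ → ZMod 2) (m : ℕ) : List StateG :=
  (List.range m).flatMap fun i => [ofBitCD (p i), ofBitAB (q i)]

theorem wordAB_succ (p q : ℕ → ZMod 2) (m : ℕ) :
    wordAB p q (m + 1) = wordAB p q m ++ [ofBitAB (p m), ofBitCD (q m)] := by
  simp [wordAB, List.range_succ]

theorem wordCD_succ (p q : ℕ → ZMod 2) (m : ℕ) :
    wordCD p q (m + 1) = wordCD p q m ++ [ofBitCD (p m), ofBitAB (q m)] := by
  simp [wordCD, List.range_succ]

theorem outWord_wordAB (p q : ℕ → ZMod 2) (m : ℕ) (x : ZMod 2) :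
    autC.outWord (wordAB p q m) (letter x) = letter (x + ∑ i ∈ Finset.range m, p i) := by
  induction m with
  | zero => exact congrArg letter (add_zero x).symm
  | succ m ih =>
    rw [wordAB_succ, MealyAutomaton.outWord_append, ih]
    simp only [MealyAutomaton.outWord]
    rw [out_ofBitAB, out_ofBitCD, Finset.sum_range_succ, add_assoc]

theorem outWord_wordCD (p q : ℕ → ZMod 2) (m : ℕ) (x : ZMod 2) :
    autC.outWord (wordCD p q m) (letter x) = letter (x + ∑ i ∈ Finset.range m, q i) := by
  induction m with
  | zero => exact congrArg letter (add_zero x).symm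
  | succ m ih =>
    rw [wordCD_succ, MealyAutomaton.outWord_append, ih]
    simp only [MealyAutomaton.outWord]
    rw [out_ofBitCD, out_ofBitAB, Finset.sum_range_succ, add_assoc]

/-- Only the states `a`, `b` move the letter, so the `i`-th state from `{c, d}` reads `x` plus the
sum of the labels in `p` up to and including `i`. -/
theorem nextWord_wordAB (p q : ℕ → ZMod 2) (m : ℕ) (x : ZMod 2) :
    autC.nextWord (wordAB p q m) (letter x) =
      wordCD p (fun i => 1 + q i + (x + ∑ j ∈ Finset.range (i + 1), p j)) m := by
  induction m with
  | zero => rfl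
  | succ m ih =>
    rw [wordAB_succ, wordCD_succ, MealyAutomaton.nextWord_append, ih, outWord_wordAB]
    simp only [MealyAutomaton.nextWord]
    rw [next_ofBitAB, out_ofBitAB, next_ofBitCD, Finset.sum_range_succ, add_assoc x]

theorem nextWord_wordCD (p q : ℕ → ZMod 2) (m : ℕ) (x : ZMod 2) :
    autC.nextWord (wordCD p q m) (letter x) =
      wordAB (fun i => 1 + p i + (x + ∑ j ∈ Finset.range i, q j)) q m := by
  induction m with
  | zero => rfl
  | succ m ih =>
    rw [wordCD_succ, wordAB_succ, MealyAutomaton.nextWord_append, ih, outWord_wordCD]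
    simp only [MealyAutomaton.nextWord]
    rw [next_ofBitCD, out_ofBitCD, next_ofBitAB]

theorem exists_wordAB {m : ℕ} {w : List StateG} (h : w.map isAB = alternating true (2 * m)) :
    ∃ p q, w = wordAB p q m := by
  induction m generalizing w with
  | zero => exact ⟨0, 0, by simpa [alternating, wordAB] using h⟩
  | succ m ih =>
    rw [show 2 * (m + 1) = 2 * m + 1 + 1 by ring] at h
    match w, h with
    | [], h => simp [alternating] at h
    | [_], h => simp [alternating] at h
    | x :: y :: w, h =>
      simp only [alternating, List.map_cons, List.cons.injEq, Bool.not_true, Bool.not_false] at h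
      obtain ⟨s, rfl⟩ := exists_ofBitAB h.1
      obtain ⟨t, rfl⟩ := exists_ofBitCD h.2.1
      obtain ⟨p, q, rfl⟩ := ih h.2.2
      refine ⟨fun i => Nat.casesOn i s p, fun i => Nat.casesOn i t q, ?_⟩
      simp [wordAB, List.range_succ_eq_map, List.flatMap_map]

/-! ### Sections as affine maps on power series -/

/-- The geometric series `1 + X + X ^ 2 + ⋯`. -/
noncomputable def geomSeries : (ZMod 2)⟦X⟧ := PowerSeries.mk 1

theorem coeff_geomSeries_mul (f : (ZMod 2)⟦X⟧) (n : ℕ) :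
    coeff n (geomSeries * f) = ∑ i ∈ Finset.range (n + 1), coeff i f := by
  rw [mul_comm, coeff_mul, Finset.Nat.sum_antidiagonal_eq_sum_range_succ_mk]
  simp [geomSeries]

theorem coeff_X_mul_geomSeries_mul (f : (ZMod 2)⟦X⟧) (n : ℕ) :
    coeff n (X * (geomSeries * f)) = ∑ i ∈ Finset.range n, coeff i f := by
  cases n with
  | zero => simp
  | succ n => rw [coeff_succ_X_mul, coeff_geomSeries_mul]

/-- The word of length `2 * m` labelled by the coefficients of two power series. -/
noncomputable def seriesWord (m : ℕ) (s : (ZMod 2)⟦X⟧ × (ZMod 2)⟦X⟧) : List StateG :=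
  wordAB (fun i => coeff i s.1) (fun i => coeff i s.2) m

/-- The second label series after passing to the section at the letter `x`. -/
noncomputable def sectionSnd (x : ZMod 2) (s : (ZMod 2)⟦X⟧ × (ZMod 2)⟦X⟧) : (ZMod 2)⟦X⟧ :=
  s.2 + geomSeries * s.1 + C (1 + x) * geomSeries

/-- The labels of the section at the word `x0`. -/
noncomputable def sectionPair (x : ZMod 2) (s : (ZMod 2)⟦X⟧ × (ZMod 2)⟦X⟧) : (ZMod 2)⟦X⟧ × (ZMod 2)⟦X⟧ :=
  (s.1 + X * (geomSeries * sectionSnd x s) + geomSeries, sectionSnd x s)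

theorem nextWord_seriesWord (m : ℕ) (x : ZMod 2) (s : (ZMod 2)⟦X⟧ × (ZMod 2)⟦X⟧) :
    autC.nextWord (seriesWord m s) (letter x) =
      wordCD (fun i => coeff i s.1) (fun i => coeff i (sectionSnd x s)) m := by
  rw [seriesWord, nextWord_wordAB]
  congr 1
  funext i
  rw [sectionSnd, map_add, map_add, coeff_geomSeries_mul, coeff_C_mul]
  simp only [geomSeries, coeff_mk, Pi.one_apply]
  ring

theorem nextWord_nextWord_seriesWord (m : ℕ) (x : ZMod 2) (s : (ZMod 2)⟦X⟧ × (ZMod 2)⟦X⟧) :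
    autC.nextWord (autC.nextWord (seriesWord m s) (letter x)) (letter 0) =
      seriesWord m (sectionPair x s) := by
  rw [nextWord_seriesWord, nextWord_wordCD, seriesWord]
  congr 1
  funext i
  rw [sectionPair, map_add, map_add, coeff_X_mul_geomSeries_mul]
  simp only [geomSeries, coeff_mk, Pi.one_apply]
  ring

/-- The section at `x` must fix the letter `0`, so its labels for `a`, `b` sum to zero. -/
theorem coeff_geomSeries_mul_sectionSnd {m : ℕ} {s : (ZMod 2)⟦X⟧ × (ZMod 2)⟦X⟧}
    (h : autC.ActsTrivially (seriesWord (m + 1) s)) (x : ZMod 2) :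
    coeff m (geomSeries * sectionSnd x s) = 0 := by
  have h1 := (h.nextWord (letter x)).outWord (letter 0)
  rw [nextWord_seriesWord, outWord_wordCD, zero_add] at h1
  rw [coeff_geomSeries_mul]
  exact h1

theorem actsTrivially_sectionPair {m : ℕ} {s : (ZMod 2)⟦X⟧ × (ZMod 2)⟦X⟧}
    (h : autC.ActsTrivially (seriesWord m s)) (x : ZMod 2) :
    autC.ActsTrivially (seriesWord m (sectionPair x s)) := by
  rw [← nextWord_nextWord_seriesWord]
  exact (h.nextWord _).nextWord _

/-- The difference of the labels of the sections of a word at `0 ⋯ 0` and `10 ⋯ 0`. -/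
noncomputable def sectionDiff : ℕ → (ZMod 2)⟦X⟧ × (ZMod 2)⟦X⟧
  | 0 => (X * (geomSeries * geomSeries), geomSeries)
  | k + 1 => ((sectionDiff k).1 +
      X * (geomSeries * ((sectionDiff k).2 + geomSeries * (sectionDiff k).1)),
      (sectionDiff k).2 + geomSeries * (sectionDiff k).1)

/-- `sectionPair 0` is affine, so a difference evolves by its linear part alone and does not depend
on `s`. -/
theorem iterate_sectionPair_eq (s : (ZMod 2)⟦X⟧ × (ZMod 2)⟦X⟧) (k : ℕ) :
    (sectionPair 0)^[k] (sectionPair 0 s) =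
      (sectionPair 0)^[k] (sectionPair 1 s) + sectionDiff k := by
  induction k with
  | zero =>
    have h : (1 + 1 : ZMod 2) = 0 := by decide
    simp only [Function.iterate_zero, id, sectionDiff, sectionPair, sectionSnd, h]
    ext1
    · simp
      ring
    · simp
  | succ k ih =>
    rw [Function.iterate_succ_apply', Function.iterate_succ_apply', ih]
    simp only [sectionDiff, sectionPair, sectionSnd]
    ext1 <;> simp <;> ring

theorem two_eq_zero_powerSeries : (2 : (ZMod 2)⟦X⟧) = 0 := by
  rw [← map_ofNat (C (R := ZMod 2)) 2, show (OfNat.ofNat 2 : ZMod 2) = 0 by decide, map_zero]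

/-- The initial case of the recurrence below, as if `(D_{-1}).2 = (D_0).2`. -/
theorem sectionDiff_snd_one :
    X * (geomSeries * geomSeries) * (sectionDiff 0).2 = (sectionDiff 0).2 + (sectionDiff 1).2 := by
  simp only [sectionDiff]
  linear_combination (-geomSeries) * two_eq_zero_powerSeries

/-- Cayley–Hamilton: the linear part of `sectionPair 0` has determinant `1` and trace `2 + X * G ^
2`, where `2 = 0`. -/
theorem sectionDiff_snd_add_two (k : ℕ) :
    X * (geomSeries * geomSeries) * (sectionDiff (k + 1)).2 =
      (sectionDiff k).2 + (sectionDiff (k + 2)).2 := by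
  simp only [sectionDiff]
  linear_combination (-(sectionDiff k).2 - geomSeries * (sectionDiff k).1) * two_eq_zero_powerSeries

theorem coeff_geomSeries_mul_sectionDiff {m : ℕ} {s : (ZMod 2)⟦X⟧ × (ZMod 2)⟦X⟧}
    (h : autC.ActsTrivially (seriesWord (m + 1) s)) (k : ℕ) :
    coeff m (geomSeries * (sectionDiff k).2) = 0 := by
  have htriv : ∀ x k, autC.ActsTrivially
      (seriesWord (m + 1) ((sectionPair 0)^[k] (sectionPair x s))) := by
    intro x k
    induction k with
    | zero => exact actsTrivially_sectionPair h x
    | succ k ih =>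
      rw [Function.iterate_succ_apply']
      exact actsTrivially_sectionPair ih 0
  have hsnd : ∀ x k, coeff m (geomSeries * ((sectionPair 0)^[k] (sectionPair x s)).2) = 0 := by
    intro x k
    cases k with
    | zero => exact coeff_geomSeries_mul_sectionSnd h x
    | succ k =>
      rw [Function.iterate_succ_apply']
      exact coeff_geomSeries_mul_sectionSnd (htriv x k) 0
  have h0 := hsnd 0 k
  rwa [iterate_sectionPair_eq, Prod.snd_add, mul_add, map_add, hsnd 1 k, zero_add] at h0

theorem not_actsTrivially_seriesWord (m : ℕ) (s : (ZMod 2)⟦X⟧ × (ZMod 2)⟦X⟧) :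
    ¬ autC.ActsTrivially (seriesWord (m + 1) s) := by
  intro h
  have key : ∀ i k : ℕ, coeff m (geomSeries *
      ((X * (geomSeries * geomSeries)) ^ i * (sectionDiff k).2)) = 0 := by
    intro i
    induction i with
    | zero => intro k; simpa using coeff_geomSeries_mul_sectionDiff h k
    | succ i ih =>
      intro k
      cases k with
      | zero =>
        rw [pow_succ, mul_assoc, sectionDiff_snd_one, mul_add, mul_add, map_add, ih, ih, add_zero]
      | succ k =>
        rw [pow_succ, mul_assoc, sectionDiff_snd_add_two, mul_add, mul_add, map_add, ih, ih,
          add_zero]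
  have h1 := key m 0
  -- The exponent `m` makes the coefficient at degree `m` the constant term of a power of `G`, which
  -- is `1`.
  rw [show geomSeries * ((X * (geomSeries * geomSeries)) ^ m * (sectionDiff 0).2) =
    X ^ m * (geomSeries * ((geomSeries * geomSeries) ^ m * geomSeries)) by
      rw [sectionDiff]; ring, coeff_X_pow_mul', if_pos le_rfl, Nat.sub_self] at h1
  have hg : constantCoeff geomSeries = 1 := by
    rw [← coeff_zero_eq_constantCoeff_apply, geomSeries, coeff_mk, Pi.one_apply]
  simp [hg] at h1

/-! ### All alternating words, and torsion -/

theorem not_actsTrivially_of_even {m : ℕ} {w : List StateG}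
    (h : w.map isAB = alternating true (2 * (m + 1))) : ¬ autC.ActsTrivially w := by
  obtain ⟨p, q, rfl⟩ := exists_wordAB h
  simpa [seriesWord] using not_actsTrivially_seriesWord m (PowerSeries.mk p, PowerSeries.mk q)

theorem not_actsTrivially_of_alternating {i : Bool} {n : ℕ} {w : List StateG}
    (h : w.map isAB = alternating i (n + 1)) : ¬ autC.ActsTrivially w := by
  have htrue : ∀ w : List StateG, w.map isAB = alternating true (n + 1) →
      ¬ autC.ActsTrivially w := by
    intro w h ht
    obtain ⟨m, hm | hm⟩ := Nat.even_or_odd' (n + 1)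
    · obtain ⟨k, rfl⟩ : ∃ k, m = k + 1 := ⟨m - 1, by omega⟩
      exact not_actsTrivially_of_even (hm ▸ h) ht
    -- Sections swap the two kinds of state, so an odd word followed by its section is again
    -- alternating, of even length.
    · refine not_actsTrivially_of_even (m := 2 * m) ?_ (ht.append (ht.nextWord 0))
      rw [List.map_append, map_isAB_nextWord, h, hm, map_not_alternating,
        alternating_append_of_odd]
      congr 1
      ring
  intro ht
  cases i with
  | true => exact htrue w h ht
  | false =>
    refine htrue _ ?_ (ht.nextWord 0)
    rw [map_isAB_nextWord, h, map_not_alternating]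
    rfl

theorem exists_map_isAB_eq_alternating {w : List StateG}
    (h : ∀ u ∈ forbiddenG, ¬ u <:+: w) (hw : w ≠ []) :
    ∃ i n, w.map isAB = alternating i (n + 1) := by
  induction w with
  | nil => exact absurd rfl hw
  | cons x w ih =>
    cases w with
    | nil => exact ⟨x.isAB, 0, rfl⟩
    | cons y w =>
      obtain ⟨i, n, hn⟩ := ih
        (fun u hu hi => h u hu (hi.trans (List.suffix_cons x _).isInfix)) (List.cons_ne_nil _ _)
      refine ⟨x.isAB, n + 1, ?_⟩
      have hxy : y.isAB = !x.isAB := by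
        have hi : [x, y] <:+: x :: y :: w := ⟨[], w, rfl⟩
        have hf : [x, y] ∉ forbiddenG := fun hf => h _ hf hi
        cases x <;> cases y <;> first | rfl | exact absurd (by simp [forbiddenG]) hf
      have hy : i = y.isAB := by
        simp only [alternating, List.map_cons, List.cons.injEq] at hn
        exact hn.1.symm
      rw [List.map_cons, hn, hy, hxy]
      rfl

/-- The elements represented by the nonempty alternating words of even length that start with
a state of the given kind. -/
noncomputable def evenSubsemigroup (i : Bool) : Subsemigroup GroupG where
  carrier := {g | ∃ (m : ℕ) (w : List StateG),
    w.map isAB = alternating i (2 * (m + 1)) ∧ evalG w = g}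
  mul_mem' := by
    rintro _ _ ⟨m, u, hu, rfl⟩ ⟨n, w, hw, rfl⟩
    refine ⟨m + n + 1, u ++ w, ?_, autC.eval_append autC_invertible u w⟩
    rw [List.map_append, hu, hw, alternating_append_of_even]
    congr 1
    ring

theorem one_notMem_evenSubsemigroup (i : Bool) : (1 : GroupG) ∉ evenSubsemigroup i := by
  rintro ⟨m, w, hw, h⟩
  exact not_actsTrivially_of_alternating (n := 2 * m + 1) hw
    (autC.actsTrivially_of_eval_eq_one autC_invertible h)

theorem hasNoTorsion_closure_of_subset {s : Set GroupG} {i : Bool}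
    (h : s ⊆ evenSubsemigroup i) : (Subsemigroup.closure s).HasNoTorsion :=
  Subsemigroup.hasNoTorsion_of_one_notMem fun h1 =>
    one_notMem_evenSubsemigroup i (Subsemigroup.closure_le.2 h h1)

theorem proposition3p7 :
    (∀ w : List StateG, w ≠ [] → (∀ u ∈ forbiddenG, ¬ u <:+: w) → evalG w ≠ 1) ∧
    (Subsemigroup.closure
      {evalG [.a, .c], evalG [.a, .d], evalG [.b, .c], evalG [.b, .d]}).HasNoTorsion ∧
    (Subsemigroup.closure
      {evalG [.c, .a], evalG [.d, .a], evalG [.c, .b], evalG [.d, .b]}).HasNoTorsion := by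
  refine ⟨fun w hw hu h => ?_, hasNoTorsion_closure_of_subset (i := true) ?_,
    hasNoTorsion_closure_of_subset (i := false) ?_⟩
  · obtain ⟨i, n, hn⟩ := exists_map_isAB_eq_alternating hu hw
    exact not_actsTrivially_of_alternating hn
      (autC.actsTrivially_of_eval_eq_one autC_invertible h)
  · rintro _ (rfl | rfl | rfl | rfl) <;> exact ⟨0, _, rfl, rfl⟩
  · rintro _ (rfl | rfl | rfl | rfl) <;> exact ⟨0, _, rfl, rfl⟩
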